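/- **Setting.** Let $\mathcal S,\mathcal A$ be finite sets, $P(\cdot\mid s,a)$ transition probabilities on $\mathcal S$, $r:\mathcal S\times\mathcal A\to[0,1]$ a reward and $\gamma\in[0,1)$ a discount factor. Let $\tau>0$. For a policy $\pi$ (a probability vector $\pi_s=\pi(\cdot\mid s)$ on $\mathcal A$ for every $s$) put $$V_\tau^\pi(s)=\mathbb E\Big[\sum_{t\ge 0}\gamma^t\big(r(s_t,a_t)-\tau\log\pi(a_t\mid s_t)\big)\,\Big|\,s_0=s,\pi\Big],\qquad V_\tau^*(s)=\sup_\pi V_\tau^\pi(s),$$ $$A_\tau^\pi(s,a)=r(s,a)+\gamma\sum_{s'}P(s'\mid s,a)V_\tau^\pi(s')-\tau\log\pi(a\mid s)-V_\tau^\pi(s).$$ Fix a distribution $\rho$ on $\mathcal S$ with $\rho(s)>0$ for all $s$, write $V(\rho)=\sum_s\rho(s)V(s)$, and let $d_\rho^\pi(s)=(1-\gamma)\,\mathbb E\big[\sum_{t\ge0}\gamma^t\mathbf 1\{s_t=s\}\mid s_0\sim\rho,\pi\big]$. For a step size $\eta>0$ and an initial policy $\pi^0$ with $\pi^0(a\mid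 s)>0$ for all $s,a$, entropy softmax NPG is the iteration $$\pi^{k+1}(a\mid s)\ \propto\ \pi^k(a\mid s)\exp\Big(\frac{\eta}{\eta\tau+1}A_\tau^{\pi^k}(s,a)\Big),\qquad k\ge 0;\qquad V^k_\tau:=V^{\pi^k}_\tau,\quad d^k_\rho:=d^{\pi^k}_\rho .$$ Write $\mathrm{KL}(p\|q)=\sum_a p_a\log(p_a/q_a)$. There is a unique policy $\pi^*$ that maximizes $V_\tau^\pi(s)$ at every $s$; put $d_\rho^*=d_\rho^{\pi^*}$. For $\varepsilon,\delta\in(0,1)$, say that $T\in\mathbb N$ is *admissible for* $(\varepsilon,\delta)$ if for all $k\ge T$ and all $s$, both for $(p,q)=(\pi^k_s,\pi^{k+1}_s)$ and for $(p,q)=(\pi^k_s,\pi^*_s)$, $$|\mathrm{KL}(p\|q)-\mathrm{KL}(q\|p)|\le\varepsilon\,\mathrm{KL}(q\|p),\qquad |\mathrm{KL}(q\|p)-\mathrm{KL}(p\|q)|\le\varepsilon\,\mathrm{KL}(p\|q),$$ and $$\Big|\frac{d_\rho^*(s)}{d_\rho^k(s)}-1\Big|\le\delta,\qquad \Big|\frac{d_\rho^k(s)}{d_\rho^*(s)}-1\Big|\le\delta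 .$$ **Theorem 6.17 (tight local linear convergence of entropy softmax NPG).** Let $\eta,\tau>0$. There are functions $\sigma_1,\sigma_2:(0,1)^2\to[0,\infty)$, depending only on $\eta$ and $\tau$, with $\sigma_1(\varepsilon,\delta)\to0$ and $\sigma_2(\varepsilon,\delta)\to0$ as $(\varepsilon,\delta)\to(0,0)$, such that in every setting as above with these $\eta,\tau$ and for all $\varepsilon,\delta\in(0,1)$: 1. an admissible $T=T(\varepsilon,\delta)$ exists; 2. for every admissible $T$ and every $k\ge T$, $$\frac{1-\sigma_1(\varepsilon,\delta)}{(\eta\tau+1)^2}\big(V_\tau^*(\rho)-V_\tau^k(\rho)\big)\le V_\tau^*(\rho)-V_\tau^{k+1}(\rho)\le\frac{1+\sigma_2(\varepsilon,\delta)}{(\eta\tau+1)^2}\big(V_\tau^*(\rho)-V_\tau^k(\rho)\big).$$ So the local linear rate $1/(\eta\tau+1)^2$ is tight: if $V_\tau^k(\rho)\ne V_\tau^*(\rho)$ for all $k$, then $$\lim_{k\to\infty}\frac{V_\tau^*(\rho)-V_\tau^{k+1}(\rho)}{V_\tau^*(\rho)-V_\tau^k(\rho)}=\frac1{(\eta\tau+1)^2}.$$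 -/

import Mathlib

open Filter Topology

universe u v

namespace EntropyNPG

/-- A finite discounted Markov decision process on the state space `S` and the action space `A`:
`P s a s'` is the probability of moving from `s` to `s'` under action `a`, the rewards lie in
`[0, 1]`, and the discount factor lies in `[0, 1)`. -/
structure MDP (S : Type u) (A : Type v) [Fintype S] where
  P : S → A → S → ℝ
  r : S → A → ℝ
  γ : ℝ
  P_mem : ∀ s a, P s a ∈ stdSimplex ℝ S
  r_mem : ∀ s a, r s a ∈ Set.Icc (0 : ℝ) 1
  γ_mem : γ ∈ Set.Ico (0 : ℝ) 1

/-- `π s a` is the probability of choosing action `a` in state `s`. -/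
def IsPolicy {S : Type u} {A : Type v} [Fintype A] (π : S → A → ℝ) : Prop :=
  ∀ s, π s ∈ stdSimplex ℝ A

/-- The Kullback-Leibler divergence `∑ a, p a log (p a / q a)` of two probability vectors with
positive entries (it is only used for such vectors). -/
noncomputable def KL {A : Type v} [Fintype A] (p q : A → ℝ) : ℝ :=
  ∑ a, p a * Real.log (p a / q a)

variable {S : Type u} {A : Type v} [Fintype S] [Fintype A]

namespace MDP

/-- The law of the state `s_t` of the trajectory with `s_0 ∼ ρ`, `a_t ∼ π(· | s_t)` and
`s_{t+1} ∼ P(· | s_t, a_t)`. -/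
def stateLaw (M : MDP S A) (π : S → A → ℝ) (ρ : S → ℝ) : ℕ → S → ℝ
  | 0 => ρ
  | t + 1 => fun s' => ∑ s, ∑ a, M.stateLaw π ρ t s * π s a * M.P s a s'

open Classical in
/-- The entropy regularized state value
`V_τ^π(s) = E[∑ t, γ ^ t (r(s_t, a_t) - τ log π(a_t | s_t)) | s_0 = s, π]`.
The pair `(s_t, a_t)` has the law `(s', a) ↦ stateLaw t s' * π s' a`; actions of probability zero
do not contribute. -/
noncomputable def value (M : MDP S A) (τ : ℝ) (π : S → A → ℝ) (s : S) : ℝ :=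
  ∑' t : ℕ, M.γ ^ t * ∑ s', ∑ a,
    M.stateLaw π (Pi.single s 1) t s' * π s' a * (M.r s' a - τ * Real.log (π s' a))

/-- `V_τ^π(ρ)`, the average of `V_τ^π(s)` over `s ∼ ρ`. -/
noncomputable def valueAt (M : MDP S A) (τ : ℝ) (π : S → A → ℝ) (ρ : S → ℝ) : ℝ :=
  ∑ s, ρ s * M.value τ π s

/-- The optimal entropy regularized state value `V_τ^*(s)`, the supremum of `V_τ^π(s)` over all
policies `π`. -/
noncomputable def optValue (M : MDP S A) (τ : ℝ) (s : S) : ℝ :=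
  ⨆ π : {π : S → A → ℝ // IsPolicy π}, M.value τ π.1 s

/-- `V_τ^*(ρ)`, the average of `V_τ^*(s)` over `s ∼ ρ`. -/
noncomputable def optValueAt (M : MDP S A) (τ : ℝ) (ρ : S → ℝ) : ℝ :=
  ∑ s, ρ s * M.optValue τ s

/-- A policy that maximizes the entropy regularized value at every state. -/
def IsOptimal (M : MDP S A) (τ : ℝ) (π : S → A → ℝ) : Prop :=
  IsPolicy π ∧ ∀ π' : S → A → ℝ, IsPolicy π' → ∀ s, M.value τ π' s ≤ M.value τ π s

/-- The entropy regularized action value `Q_τ^π(s, a)`. -/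
noncomputable def qValue (M : MDP S A) (τ : ℝ) (π : S → A → ℝ) (s : S) (a : A) : ℝ :=
  M.r s a + M.γ * ∑ s', M.P s a s' * M.value τ π s'

/-- The entropy regularized advantage `A_τ^π(s, a) = Q_τ^π(s, a) - τ log π(a | s) - V_τ^π(s)`. -/
noncomputable def advantage (M : MDP S A) (τ : ℝ) (π : S → A → ℝ) (s : S) (a : A) : ℝ :=
  M.qValue τ π s a - τ * Real.log (π s a) - M.value τ π s

/-- The discounted visitation measure `d_ρ^π(s) = (1 - γ) E[∑ t, γ ^ t 1{s_t = s} | s_0 ∼ ρ, π]`. -/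
noncomputable def visitation (M : MDP S A) (π : S → A → ℝ) (ρ : S → ℝ) (s : S) : ℝ :=
  (1 - M.γ) * ∑' t : ℕ, M.γ ^ t * M.stateLaw π ρ t s

/-- One step of entropy softmax NPG with step size `η`: the new policy is proportional to
`π(a | s) exp (η / (η τ + 1) A_τ^π(s, a))`. -/
noncomputable def npgStep (M : MDP S A) (τ η : ℝ) (π : S → A → ℝ) : S → A → ℝ := fun s a =>
  π s a * Real.exp (η / (η * τ + 1) * M.advantage τ π s a) /
    ∑ a', π s a' * Real.exp (η / (η * τ + 1) * M.advantage τ π s a')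

/-- The iterates `π^k` of entropy softmax NPG with constant step size `η`, started at `π₀`. -/
noncomputable def npg (M : MDP S A) (τ η : ℝ) (π₀ : S → A → ℝ) (k : ℕ) : S → A → ℝ :=
  (M.npgStep τ η)^[k] π₀

end MDP

/-- The ratio of the KL divergences of `p, q` in the two orders lies within `ε` of `1`, whichever
of them is the denominator. Denominators are cleared since both divergences vanish for `p = q`. -/
def KLRatioClose (ε : ℝ) (p q : A → ℝ) : Prop :=
  |KL p q - KL q p| ≤ ε * KL q p ∧ |KL q p - KL p q| ≤ ε * KL p q

/-- From time `T` on, the KL divergences between consecutive iterates, and those between the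
iterates and `πs`, are symmetric up to the relative error `ε` at every state, and the visitation
measures of the iterates agree with that of `πs` up to the relative error `δ`. -/
def LocalRegime (M : MDP S A) (τ η : ℝ) (ρ : S → ℝ) (π₀ πs : S → A → ℝ) (ε δ : ℝ) (T : ℕ) : Prop :=
  ∀ k ≥ T, ∀ s,
    KLRatioClose ε (M.npg τ η π₀ k s) (M.npg τ η π₀ (k + 1) s) ∧
    KLRatioClose ε (M.npg τ η π₀ k s) (πs s) ∧
    |M.visitation πs ρ s / M.visitation (M.npg τ η π₀ k) ρ s - 1| ≤ δ ∧
    |M.visitation (M.npg τ η π₀ k) ρ s / M.visitation πs ρ s - 1| ≤ δ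

end EntropyNPG

open EntropyNPG

/-! ### Visitation measures, performance difference and the Bellman equation. -/

namespace EntropyNPG

/-! Write α = ητ + 1, p = π^k, q = π^{k+1}, and let X, Y be the suboptimalities of p, q up to the
common factor τ/(1-γ). The proof compares three exact identities, all instances of the performance
difference lemma `MDP.valueAt_sub`.

Since τ log π* = Q* - V*, suboptimality is a visitation-weighted divergence: X = ∑ d^p KL(p‖π*), and
likewise Y (`MDP.valueAt_sub_valueAt`). The three point identity `MDP.bellmanGap_eq_KL`, tested at
π* and at q, gives (α-1)X = B - αC + αE and (α-1)(X-Y) = ∑ d^q (KL(q‖p) + α KL(p‖q)), where B, C, E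
are the d*-averages of KL(π*‖p), KL(π*‖q), KL(p‖q).

In the local regime divergences are nearly symmetric and visitations nearly equal, so B ≈ X, C ≈ Y
and (1+α)E ≈ (α-1)(X-Y). Eliminating B, C, E leaves α²Y ≈ X, with relative error linear in ε and δ
(`LocalRegime.abs_sub_le`).

The regime is reached because the iterates converge (`MDP.exists_tendsto_npg`): values increase and
are bounded, so the Q-values converge, and the log-ratios of action probabilities follow a recursion
contracting by 1/α. The limit is a softmax policy with zero advantage, which is the unique optimum.
Positive limits make probability ratios tend to 1, which makes KL asymptotically symmetric
(`klTerm_le_mul_klTerm`). -/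

theorem MDP.one_sub_γ_pos {S : Type u} {A : Type v} [Fintype S] (M : MDP S A) : 0 < 1 - M.γ :=
  sub_pos.2 M.γ_mem.2

variable {S : Type u} {A : Type v} [Fintype S] [Fintype A]

namespace MDP

variable (M : MDP S A)

theorem stateLaw_mem {π : S → A → ℝ} {ρ : S → ℝ} (hπ : IsPolicy π) (hρ : ρ ∈ stdSimplex ℝ S)
    (t : ℕ) : M.stateLaw π ρ t ∈ stdSimplex ℝ S := by
  induction t with
  | zero => exact hρ
  | succ t ih =>
    refine ⟨fun s' => Finset.sum_nonneg fun s _ => Finset.sum_nonneg fun a _ =>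
      mul_nonneg (mul_nonneg (ih.1 s) ((hπ s).1 a)) ((M.P_mem s a).1 s'), ?_⟩
    simp only [stateLaw]
    rw [Finset.sum_comm]
    rw [← ih.2]
    refine Finset.sum_congr rfl fun s _ => ?_
    rw [Finset.sum_comm]
    simp_rw [← Finset.mul_sum, (M.P_mem s _).2, mul_one, ← Finset.mul_sum, (hπ s).2, mul_one]

open Classical in
-- Linearity in the initial distribution: it transfers statements about point masses, where `value`
-- is defined, to general ρ.
theorem stateLaw_eq_sum (π : S → A → ℝ) (ρ : S → ℝ) (t : ℕ) (s' : S) :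
    M.stateLaw π ρ t s' = ∑ s, ρ s * M.stateLaw π (Pi.single s 1) t s' := by
  induction t generalizing s' with
  | zero => simp [stateLaw, Pi.single_apply]
  | succ t ih =>
    simp only [stateLaw]
    simp_rw [ih, Finset.mul_sum, Finset.sum_mul]
    rw [Finset.sum_comm' (t' := Finset.univ) (s' := fun _ => Finset.univ) (by simp)]
    refine Eq.trans ?_ (Finset.sum_comm)
    rw [Finset.sum_comm]
    refine Finset.sum_congr rfl fun s _ => ?_
    rw [Finset.sum_comm]
    refine Finset.sum_congr rfl fun s _ => ?_
    refine Finset.sum_congr rfl fun a _ => ?_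
    ring

theorem stateLaw_succ' (π : S → A → ℝ) (ρ : S → ℝ) (t : ℕ) :
    M.stateLaw π ρ (t + 1) = M.stateLaw π (M.stateLaw π ρ 1) t := by
  induction t with
  | zero => rfl
  | succ t ih => rw [stateLaw, ih]; rfl

theorem summable_discounted_stateLaw {π : S → A → ℝ} {ρ : S → ℝ} (hπ : IsPolicy π)
    (hρ : ρ ∈ stdSimplex ℝ S) (s : S) : Summable fun t : ℕ => M.γ ^ t * M.stateLaw π ρ t s := by
  refine Summable.of_nonneg_of_le (fun t => ?_) (fun t => ?_)
    (summable_geometric_of_lt_one M.γ_mem.1 M.γ_mem.2)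
  · exact mul_nonneg (pow_nonneg M.γ_mem.1 _) ((M.stateLaw_mem hπ hρ t).1 s)
  · refine mul_le_of_le_one_right (pow_nonneg M.γ_mem.1 _) ?_
    have h := M.stateLaw_mem hπ hρ t
    rw [← h.2]
    exact Finset.single_le_sum (fun i _ => h.1 i) (Finset.mem_univ s)

theorem visitation_nonneg {π : S → A → ℝ} {ρ : S → ℝ} (hπ : IsPolicy π)
    (hρ : ρ ∈ stdSimplex ℝ S) (s : S) : 0 ≤ M.visitation π ρ s :=
  mul_nonneg M.one_sub_γ_pos.le (tsum_nonneg fun t =>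
    mul_nonneg (pow_nonneg M.γ_mem.1 _) ((M.stateLaw_mem hπ hρ t).1 s))

open Classical in
theorem single_mem (s : S) : (Pi.single s 1 : S → ℝ) ∈ stdSimplex ℝ S := by
  convert single_mem_stdSimplex ℝ s

theorem hasSum_visitation {π : S → A → ℝ} {ρ : S → ℝ} (hπ : IsPolicy π)
    (hρ : ρ ∈ stdSimplex ℝ S) (s : S) :
    HasSum (fun t : ℕ => M.γ ^ t * M.stateLaw π ρ t s) ((1 - M.γ)⁻¹ * M.visitation π ρ s) := by
  have := (M.summable_discounted_stateLaw hπ hρ s).hasSum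
  rwa [visitation, inv_mul_cancel_left₀ M.one_sub_γ_pos.ne']

theorem hasSum_discounted {π : S → A → ℝ} {ρ : S → ℝ} (hπ : IsPolicy π)
    (hρ : ρ ∈ stdSimplex ℝ S) (g : S → ℝ) :
    HasSum (fun t : ℕ => M.γ ^ t * ∑ s, M.stateLaw π ρ t s * g s)
      ((1 - M.γ)⁻¹ * ∑ s, M.visitation π ρ s * g s) := by
  have h := hasSum_sum (s := Finset.univ) fun s _ =>
    (M.hasSum_visitation hπ hρ s).mul_right (g s)
  simpa only [Finset.mul_sum, mul_assoc] using h

open Classical in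
theorem visitation_eq_sum {π : S → A → ℝ} (ρ : S → ℝ) (hπ : IsPolicy π) (s' : S) :
    M.visitation π ρ s' = ∑ s, ρ s * M.visitation π (Pi.single s 1) s' := by
  have h := hasSum_sum (s := Finset.univ) fun s _ =>
    (M.hasSum_visitation hπ (single_mem s) s').mul_left (ρ s)
  have h' : (fun t : ℕ => M.γ ^ t * M.stateLaw π ρ t s') =
      fun t => ∑ s, ρ s * (M.γ ^ t * M.stateLaw π (Pi.single s 1) t s') := by
    ext t
    rw [stateLaw_eq_sum, Finset.mul_sum]
    exact Finset.sum_congr rfl fun s _ => by ring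
  rw [visitation, h', h.tsum_eq, Finset.mul_sum]
  refine Finset.sum_congr rfl fun s _ => ?_
  have := M.one_sub_γ_pos.ne'
  field_simp

/-- Conditioning on the first step of the trajectory. -/
theorem visitation_eq_first {π : S → A → ℝ} {ρ : S → ℝ} (hπ : IsPolicy π)
    (hρ : ρ ∈ stdSimplex ℝ S) (s : S) :
    M.visitation π ρ s = (1 - M.γ) * ρ s + M.γ * M.visitation π (M.stateLaw π ρ 1) s := by
  simp only [visitation]
  rw [(M.summable_discounted_stateLaw hπ hρ s).tsum_eq_zero_add]
  have h : ∀ t, M.γ ^ (t + 1) * M.stateLaw π ρ (t + 1) s =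
      M.γ * (M.γ ^ t * M.stateLaw π (M.stateLaw π ρ 1) t s) := fun t => by
    rw [stateLaw_succ', pow_succ', mul_assoc]
  simp_rw [h, tsum_mul_left, pow_zero, one_mul]
  rw [show M.stateLaw π ρ 0 s = ρ s from rfl]
  ring

/-- Conditioning on the last step of the trajectory. -/
theorem visitation_eq_last {π : S → A → ℝ} {ρ : S → ℝ} (hπ : IsPolicy π)
    (hρ : ρ ∈ stdSimplex ℝ S) (s' : S) :
    M.visitation π ρ s' = (1 - M.γ) * ρ s' +
      M.γ * ∑ s, M.visitation π ρ s * ∑ a, π s a * M.P s a s' := by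
  have h := (M.hasSum_discounted hπ hρ fun s => ∑ a, π s a * M.P s a s').tsum_eq
  rw [visitation, (M.summable_discounted_stateLaw hπ hρ s').tsum_eq_zero_add]
  have h2 : ∀ t, M.γ ^ (t + 1) * M.stateLaw π ρ (t + 1) s' =
      M.γ * (M.γ ^ t * ∑ s, M.stateLaw π ρ t s * ∑ a, π s a * M.P s a s') := fun t => by
    simp only [stateLaw, Finset.mul_sum, pow_succ']
    refine Finset.sum_congr rfl fun s _ => Finset.sum_congr rfl fun a _ => by ring
  simp_rw [h2, tsum_mul_left, h]
  have := M.one_sub_γ_pos.ne'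
  simp only [stateLaw, pow_zero, one_mul]
  field_simp

/-- The time-zero term alone contributes this much. Hence full support of ρ keeps all visitations
positive, and relative errors make sense. -/
theorem le_visitation {π : S → A → ℝ} {ρ : S → ℝ} (hπ : IsPolicy π)
    (hρ : ρ ∈ stdSimplex ℝ S) (s : S) : (1 - M.γ) * ρ s ≤ M.visitation π ρ s := by
  rw [M.visitation_eq_first hπ hρ]
  have := mul_nonneg M.γ_mem.1 (M.visitation_nonneg hπ (M.stateLaw_mem hπ hρ 1) s)
  linarith

theorem visitation_pos {π : S → A → ℝ} {ρ : S → ℝ} (hπ : IsPolicy π)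
    (hρ : ρ ∈ stdSimplex ℝ S) {s : S} (hs : 0 < ρ s) : 0 < M.visitation π ρ s :=
  (mul_pos M.one_sub_γ_pos hs).trans_le (M.le_visitation hπ hρ s)

open Classical in
theorem value_eq {τ : ℝ} {π : S → A → ℝ} (hπ : IsPolicy π) (s : S) :
    M.value τ π s = (1 - M.γ)⁻¹ * ∑ s', M.visitation π (Pi.single s 1) s' *
      ∑ a, π s' a * (M.r s' a - τ * Real.log (π s' a)) := by
  rw [← (M.hasSum_discounted hπ (single_mem s) _).tsum_eq, value]
  simp only [Finset.mul_sum, mul_assoc]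

theorem valueAt_eq {τ : ℝ} {π : S → A → ℝ} (ρ : S → ℝ) (hπ : IsPolicy π) :
    M.valueAt τ π ρ = (1 - M.γ)⁻¹ * ∑ s', M.visitation π ρ s' *
      ∑ a, π s' a * (M.r s' a - τ * Real.log (π s' a)) := by
  classical
  rw [valueAt]
  simp_rw [M.value_eq hπ, M.visitation_eq_sum ρ hπ, Finset.sum_mul, Finset.mul_sum]
  rw [Finset.sum_comm]
  refine Finset.sum_congr rfl fun s _ => Finset.sum_congr rfl fun a _ => ?_
  refine Finset.sum_congr rfl fun s _ => by ring

open Classical in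
theorem valueAt_single (τ : ℝ) (π : S → A → ℝ) (s : S) :
    M.valueAt τ π (Pi.single s 1) = M.value τ π s := by
  simp [valueAt, Pi.single_apply]

/-- The residual of `U` in the entropy regularized Bellman equation of the policy `π`. -/
noncomputable def bellmanGap (τ : ℝ) (U : S → ℝ) (π : S → A → ℝ) (s : S) : ℝ :=
  ∑ a, π s a * (M.r s a + M.γ * ∑ s', M.P s a s' * U s' - τ * Real.log (π s a)) - U s

/-- The performance difference lemma, relative to an arbitrary function `U`. -/
theorem valueAt_sub {τ : ℝ} {π : S → A → ℝ} {ρ : S → ℝ} (hπ : IsPolicy π)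
    (hρ : ρ ∈ stdSimplex ℝ S) (U : S → ℝ) :
    M.valueAt τ π ρ - ∑ s, ρ s * U s =
      (1 - M.γ)⁻¹ * ∑ s, M.visitation π ρ s * M.bellmanGap τ U π s := by
  -- The flow equation of the visitation measure, integrated against `U`; it makes the `U` terms of
  -- the Bellman gaps telescope to their initial value.
  have h : ∑ s', M.visitation π ρ s' * U s' = (1 - M.γ) * ∑ s, ρ s * U s +
      M.γ * ∑ s, M.visitation π ρ s * ∑ a, π s a * ∑ s', M.P s a s' * U s' := by
    rw [Finset.sum_congr rfl fun s' _ => by rw [M.visitation_eq_last hπ hρ s']]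
    simp only [add_mul, Finset.sum_add_distrib, Finset.mul_sum, Finset.sum_mul, mul_assoc]
    congr 1
    rw [Finset.sum_comm]
    refine Finset.sum_congr rfl fun s _ => ?_
    rw [Finset.sum_comm]
  have h1 : ∑ s, M.visitation π ρ s * M.bellmanGap τ U π s =
      (∑ s, M.visitation π ρ s * ∑ a, π s a * (M.r s a - τ * Real.log (π s a))) +
      M.γ * (∑ s, M.visitation π ρ s * ∑ a, π s a * ∑ s', M.P s a s' * U s') -
      ∑ s', M.visitation π ρ s' * U s' := by
    rw [Finset.mul_sum, ← Finset.sum_add_distrib, ← Finset.sum_sub_distrib]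
    refine Finset.sum_congr rfl fun s _ => ?_
    have h2 : ∑ a, π s a * (M.r s a + M.γ * ∑ s', M.P s a s' * U s' - τ * Real.log (π s a)) =
        (∑ a, π s a * (M.r s a - τ * Real.log (π s a))) +
          M.γ * ∑ a, π s a * ∑ s', M.P s a s' * U s' := by
      rw [Finset.mul_sum, ← Finset.sum_add_distrib]
      exact Finset.sum_congr rfl fun a _ => by ring
    rw [bellmanGap, h2]
    ring
  rw [h1, h, M.valueAt_eq ρ hπ]
  have := M.one_sub_γ_pos.ne'
  field_simp
  ring

/-- The Bellman equation of a policy. -/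
theorem bellmanGap_self {τ : ℝ} {π : S → A → ℝ} (hπ : IsPolicy π) (s : S) :
    M.bellmanGap τ (M.value τ π) π s = 0 := by
  classical
  set c : S → ℝ := fun s => ∑ a, π s a * (M.r s a - τ * Real.log (π s a)) with hc
  have h := M.valueAt_eq (τ := τ) (Pi.single s 1) hπ
  have h1 := M.valueAt_eq (τ := τ) (M.stateLaw π (Pi.single s 1) 1) hπ
  -- Restarting from the law of s_1 averages the values of the successor states.
  have h2 : M.valueAt τ π (M.stateLaw π (Pi.single s 1) 1) =
      ∑ a, π s a * ∑ s', M.P s a s' * M.value τ π s' := by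
    simp only [valueAt, stateLaw, Pi.single_apply]
    simp only [ite_mul, one_mul, zero_mul, Finset.sum_mul, Finset.mul_sum, mul_assoc]
    rw [Finset.sum_comm, Finset.sum_eq_single s _ (by simp)]
    · simp only [if_true]
      exact Finset.sum_comm
    · intro b _ hb
      simp [hb]
  rw [valueAt_single] at h
  simp_rw [M.visitation_eq_first hπ (single_mem s)] at h
  simp only [add_mul, Finset.sum_add_distrib] at h
  have h3 : ∑ x, (1 - M.γ) * (Pi.single s 1 : S → ℝ) x * c x = (1 - M.γ) * c s := by
    simp [Pi.single_apply]
  rw [h3] at h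
  simp_rw [mul_assoc, ← Finset.mul_sum] at h
  have h4 : M.value τ π s = c s + M.γ * ∑ a, π s a * ∑ s', M.P s a s' * M.value τ π s' := by
    rw [h, ← h2, h1]
    have := M.one_sub_γ_pos.ne'
    field_simp
  rw [bellmanGap, sub_eq_zero]
  refine Eq.trans ?_ h4.symm
  rw [hc, Finset.mul_sum, ← Finset.sum_add_distrib]
  exact Finset.sum_congr rfl fun a _ => by ring

/-- With zero gap, the performance difference from a point mass vanishes. This later identifies the
limit of the values with the value of the limit policy. -/
theorem value_eq_of_bellmanGap_eq_zero {τ : ℝ} {π : S → A → ℝ} (hπ : IsPolicy π) {U : S → ℝ}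
    (hU : ∀ s, M.bellmanGap τ U π s = 0) (s : S) : M.value τ π s = U s := by
  classical
  have h := M.valueAt_sub (τ := τ) hπ (single_mem s) U
  simp only [hU, valueAt_single, mul_zero, Finset.sum_const_zero] at h
  simpa [Pi.single_apply, sub_eq_zero] using h

end MDP

end EntropyNPG

/-! ### Near-symmetry of the KL divergence, and contracting affine recursions. -/

namespace EntropyNPG

theorem two_mul_sub_one_le_mul_log {x : ℝ} (hx : 1 ≤ x) : 2 * (x - 1) ≤ (x + 1) * Real.log x := by
  have h := Real.le_log_one_add_of_nonneg (sub_nonneg.2 hx)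
  rw [div_le_iff₀ (by linarith), show 1 + (x - 1) = x by ring] at h
  linarith

theorem two_mul_log_le_sub_inv {x : ℝ} (hx : 1 ≤ x) : 2 * Real.log x ≤ x - x⁻¹ := by
  have h := Real.self_le_sinh_iff.2 (Real.log_nonneg hx)
  rw [Real.sinh_log (by linarith)] at h
  linarith

/-- The summand of the KL divergence, normalized to be nonnegative. -/
noncomputable def klTerm (p q : ℝ) : ℝ := p * Real.log (p / q) - p + q

theorem klTerm_pos {p q : ℝ} (hp : 0 ≤ p) (hq : 0 < q) (h : p ≠ q) : 0 < klTerm p q := by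
  rcases hp.eq_or_lt with rfl | hp
  · simpa [klTerm]
  · have h1 : Real.log (q / p) < q / p - 1 :=
      Real.log_lt_sub_one_of_pos (div_pos hq hp) fun h' => h ((div_eq_one_iff_eq hp.ne').1 h').symm
    have h2 := mul_lt_mul_of_pos_left h1 hp
    rw [mul_sub, mul_div_cancel₀ _ hp.ne', ← inv_div, Real.log_inv] at h2
    rw [klTerm]
    linarith

theorem klTerm_self (p : ℝ) : klTerm p p = 0 := by
  rcases eq_or_ne p 0 with rfl | h <;> simp [klTerm, *]

theorem klTerm_nonneg {p q : ℝ} (hp : 0 ≤ p) (hq : 0 < q) : 0 ≤ klTerm p q := by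
  rcases eq_or_ne p q with rfl | h
  · rw [klTerm_self]
  · exact (klTerm_pos hp hq h).le

/-- The two orders of the KL summand agree up to the ratio of the arguments. -/
theorem klTerm_le_mul_klTerm {c p q : ℝ} (hp : 0 < p) (hq : 0 < q) (hc : 1 ≤ c)
    (hpq : p / q ≤ c) : klTerm p q ≤ c * klTerm q p := by
  have hq0 := klTerm_nonneg hq.le hp
  have hlog : Real.log (q / p) = -Real.log (p / q) := by rw [← inv_div, Real.log_inv]
  -- For p ≤ q the term in the order (p, q) is already the smaller one; for q ≤ p the factor p / q
  -- suffices. Each case is one of the two logarithm inequalities, applied to the ratio that is at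
  -- least 1.
  rcases le_total p q with h | h
  · refine le_trans ?_ (le_mul_of_one_le_left hq0 hc)
    have h1 := two_mul_sub_one_le_mul_log ((one_le_div hp).2 h)
    have h2 := mul_le_mul_of_nonneg_left h1 hp.le
    have h3 : p * (2 * (q / p - 1)) = 2 * (q - p) := by field_simp
    have h4 : p * ((q / p + 1) * Real.log (q / p)) = (q + p) * Real.log (q / p) := by field_simp
    rw [h3, h4, hlog] at h2
    rw [klTerm, klTerm, hlog]
    linarith
  · refine le_trans ?_ (mul_le_mul_of_nonneg_right hpq hq0)
    have h1 := mul_le_mul_of_nonneg_left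
      (two_mul_log_le_sub_inv ((one_le_div hq).2 h)) hp.le
    have h3 : p * (p / q - (p / q)⁻¹) = p / q * p - q := by field_simp
    have h4 : p / q * (q * -Real.log (p / q) - q + p) =
      -(p * Real.log (p / q)) - p + p / q * p := by field_simp
    rw [h3] at h1
    rw [klTerm, klTerm, hlog, h4]
    linarith

variable {A : Type v} [Fintype A]

/-- The corrections -p + q cancel because both vectors have total mass 1; divergences can then be
compared term by term. -/
theorem KL_eq_sum_klTerm {p q : A → ℝ} (hp : p ∈ stdSimplex ℝ A) (hq : q ∈ stdSimplex ℝ A) :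
    KL p q = ∑ a, klTerm (p a) (q a) := by
  simp [klTerm, KL, Finset.sum_add_distrib, Finset.sum_sub_distrib, hp.2, hq.2]

theorem KL_nonneg {p q : A → ℝ} (hp : p ∈ stdSimplex ℝ A) (hq : q ∈ stdSimplex ℝ A)
    (hq0 : ∀ a, 0 < q a) : 0 ≤ KL p q := by
  rw [KL_eq_sum_klTerm hp hq]
  exact Finset.sum_nonneg fun a _ => klTerm_nonneg (hp.1 a) (hq0 a)

theorem eq_of_KL_eq_zero {p q : A → ℝ} (hp : p ∈ stdSimplex ℝ A) (hq : q ∈ stdSimplex ℝ A)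
    (hq0 : ∀ a, 0 < q a) (h : KL p q = 0) : p = q := by
  rw [KL_eq_sum_klTerm hp hq,
    Finset.sum_eq_zero_iff_of_nonneg fun a _ => klTerm_nonneg (hp.1 a) (hq0 a)] at h
  ext a
  by_contra hne
  exact (klTerm_pos (hp.1 a) (hq0 a) hne).ne' (h a (Finset.mem_univ a))

theorem KL_le_mul_KL {c : ℝ} {p q : A → ℝ} (hp : p ∈ stdSimplex ℝ A) (hq : q ∈ stdSimplex ℝ A)
    (hp0 : ∀ a, 0 < p a) (hq0 : ∀ a, 0 < q a) (hc : 1 ≤ c) (h : ∀ a, p a / q a ≤ c) :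
    KL p q ≤ c * KL q p := by
  rw [KL_eq_sum_klTerm hp hq, KL_eq_sum_klTerm hq hp, Finset.mul_sum]
  exact Finset.sum_le_sum fun a _ => klTerm_le_mul_klTerm (hp0 a) (hq0 a) hc (h a)

theorem klRatioClose_of_ratio_le {ε : ℝ} {p q : A → ℝ} (hp : p ∈ stdSimplex ℝ A)
    (hq : q ∈ stdSimplex ℝ A) (hp0 : ∀ a, 0 < p a) (hq0 : ∀ a, 0 < q a) (hε : 0 ≤ ε)
    (h : ∀ a, p a / q a ≤ 1 + ε) (h' : ∀ a, q a / p a ≤ 1 + ε) : KLRatioClose ε p q := by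
  have h1 := KL_le_mul_KL hp hq hp0 hq0 (by linarith) h
  have h2 := KL_le_mul_KL hq hp hq0 hp0 (by linarith) h'
  have h3 := KL_nonneg hp hq hq0
  have h4 := KL_nonneg hq hp hp0
  -- The lower bounds come from the opposite ratio bound, as 1/(1+ε) ≥ 1-ε.
  constructor <;> rw [abs_le] <;> constructor <;>
    nlinarith [mul_nonneg hε h3, mul_nonneg hε h4, mul_nonneg (mul_nonneg hε hε) h3,
      mul_nonneg (mul_nonneg hε hε) h4, mul_le_mul_of_nonneg_left h1 hε,
      mul_le_mul_of_nonneg_left h2 hε]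

theorem eventually_klRatioClose {ε : ℝ} (hε : 0 < ε) {p q : ℕ → A → ℝ} {l : A → ℝ}
    (hp : ∀ k, p k ∈ stdSimplex ℝ A) (hq : ∀ k, q k ∈ stdSimplex ℝ A)
    (hp0 : ∀ k a, 0 < p k a) (hq0 : ∀ k a, 0 < q k a) (hl : ∀ a, 0 < l a)
    (hpl : ∀ a, Tendsto (fun k => p k a) atTop (𝓝 (l a)))
    (hql : ∀ a, Tendsto (fun k => q k a) atTop (𝓝 (l a))) :
    ∀ᶠ k in atTop, KLRatioClose ε (p k) (q k) := by
  have key : ∀ {x y : ℕ → ℝ} {z : ℝ}, 0 < z → Tendsto x atTop (𝓝 z) → Tendsto y atTop (𝓝 z) →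
      ∀ᶠ k in atTop, x k / y k ≤ 1 + ε := fun hz hx hy => by
    have := hx.div hy hz.ne'
    rw [div_self hz.ne'] at this
    exact this.eventually (eventually_le_nhds (by linarith))
  filter_upwards [eventually_all.2 fun a => key (hl a) (hpl a) (hql a),
    eventually_all.2 fun a => key (hl a) (hql a) (hpl a)] with k h1 h2
  exact klRatioClose_of_ratio_le (hp k) (hq k) (hp0 k) (hq0 k) hε.le h1 h2

/-- A contracting affine recursion with convergent input converges to the limiting fixed point. -/
theorem tendsto_of_contracting_recursion {β b : ℝ} (hβ : 0 ≤ β) (hβ1 : β < 1) {x e : ℕ → ℝ}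
    (he : Tendsto e atTop (𝓝 b)) (hx : ∀ k, x (k + 1) = β * x k + e k) :
    Tendsto x atTop (𝓝 (b / (1 - β))) := by
  have hβ' : 0 < 1 - β := sub_pos.2 hβ1
  rw [Metric.tendsto_atTop] at he ⊢
  intro ε hε
  -- With this tolerance the error level ε/2 is reproduced by one step: β(ε/2) + (1-β)(ε/2) = ε/2.
  obtain ⟨N, hN⟩ := he ((1 - β) * (ε / 2)) (by positivity)
  set l := b / (1 - β) with hl
  have hb : b = (1 - β) * l := by rw [hl]; field_simp
  have h : ∀ n, |x (N + n) - l| ≤ β ^ n * |x N - l| + ε / 2 := by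
    intro n
    induction n with
    | zero => simp; positivity
    | succ n ih =>
      have h1 := (hN (N + n) (by omega)).le
      rw [Real.dist_eq] at h1
      have h2 : x (N + (n + 1)) - l = β * (x (N + n) - l) + (e (N + n) - b) := by
        rw [← add_assoc, hx, hb]; ring
      calc |x (N + (n + 1)) - l| ≤ β * |x (N + n) - l| + |e (N + n) - b| := by
            rw [h2, ← abs_of_nonneg hβ, ← abs_mul, abs_of_nonneg hβ]; exact abs_add_le _ _
        _ ≤ β * (β ^ n * |x N - l| + ε / 2) + (1 - β) * (ε / 2) := by gcongr
        _ = β ^ (n + 1) * |x N - l| + ε / 2 := by ring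
  have h3 : Tendsto (fun n => β ^ n * |x N - l|) atTop (𝓝 0) := by
    simpa using (tendsto_pow_atTop_nhds_zero_of_lt_one hβ hβ1).mul_const |x N - l|
  obtain ⟨n₀, hn₀⟩ := eventually_atTop.1 (h3.eventually (gt_mem_nhds (half_pos hε)))
  refine ⟨N + n₀, fun n hn => ?_⟩
  obtain ⟨m, rfl⟩ := Nat.exists_eq_add_of_le (show N ≤ n by omega)
  rw [Real.dist_eq]
  linarith [h m, hn₀ m (by omega)]

end EntropyNPG

/-! ### The NPG step as mirror descent, and policy improvement. -/

namespace EntropyNPG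

variable {S : Type u} {A : Type v} [Fintype S] [Fintype A]

namespace MDP

variable (M : MDP S A)

section Step

variable {τ η : ℝ} {π : S → A → ℝ}

theorem npgStep_normalizer_pos (hπ : IsPolicy π) (hπ0 : ∀ s a, 0 < π s a) (s : S) :
    0 < ∑ a, π s a * Real.exp (η / (η * τ + 1) * M.advantage τ π s a) := by
  have : Nonempty A := by
    by_contra h
    rw [not_nonempty_iff] at h
    simpa using (hπ s).2
  exact Finset.sum_pos (fun a _ => mul_pos (hπ0 s a) (Real.exp_pos _)) Finset.univ_nonempty

theorem npgStep_pos (hπ : IsPolicy π) (hπ0 : ∀ s a, 0 < π s a) (s : S) (a : A) :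
    0 < M.npgStep τ η π s a :=
  div_pos (mul_pos (hπ0 s a) (Real.exp_pos _)) (M.npgStep_normalizer_pos hπ hπ0 s)

theorem npgStep_isPolicy (hπ : IsPolicy π) (hπ0 : ∀ s a, 0 < π s a) :
    IsPolicy (M.npgStep τ η π) := fun s => by
  refine ⟨fun a => (M.npgStep_pos hπ hπ0 s a).le, ?_⟩
  simp only [npgStep]
  rw [← Finset.sum_div, div_self (M.npgStep_normalizer_pos hπ hπ0 s).ne']

/-- The advantage contains -τ log π, so the coefficient of log π after the step is 1 - ητ/(ητ+1) =
1/(ητ+1). This is the source both of the three point identity and of the contraction of log-ratios.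
-/
theorem log_npgStep (hα : η * τ + 1 ≠ 0) (hπ : IsPolicy π) (hπ0 : ∀ s a, 0 < π s a) (s : S)
    (a : A) :
    (η * τ + 1) * Real.log (M.npgStep τ η π s a) =
      Real.log (π s a) + η * M.qValue τ π s a - η * M.value τ π s - (η * τ + 1) *
        Real.log (∑ a, π s a * Real.exp (η / (η * τ + 1) * M.advantage τ π s a)) := by
  have hZ := M.npgStep_normalizer_pos (τ := τ) (η := η) hπ hπ0 s
  simp only [npgStep]
  rw [Real.log_div (mul_pos (hπ0 s a) (Real.exp_pos _)).ne' hZ.ne',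
    Real.log_mul (hπ0 s a).ne' (Real.exp_pos _).ne', Real.log_exp]
  rw [mul_sub, mul_add, ← mul_assoc, mul_div_cancel₀ _ hα, advantage]
  ring

theorem bellmanGap_value_eq (p : S → A → ℝ) (s : S) :
    M.bellmanGap τ (M.value τ π) p s =
      ∑ a, p s a * (M.qValue τ π s a - τ * Real.log (p s a)) - M.value τ π s := rfl

theorem KL_eq_sum_sub {p q : A → ℝ} (hp : ∀ a, 0 < p a) (hq : ∀ a, 0 < q a) :
    KL p q = ∑ a, p a * (Real.log (p a) - Real.log (q a)) := by
  simp_rw [KL, Real.log_div (hp _).ne' (hq _).ne']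

/-- The three point identity of the mirror descent step. -/
theorem bellmanGap_eq_KL (hα : η * τ + 1 ≠ 0) (hπ : IsPolicy π) (hπ0 : ∀ s a, 0 < π s a)
    {p : S → A → ℝ} (hp : IsPolicy p) (hp0 : ∀ s a, 0 < p s a) (s : S) :
    η * M.bellmanGap τ (M.value τ π) p s =
      KL (p s) (π s) - (η * τ + 1) * KL (p s) (M.npgStep τ η π s) +
        (η * τ + 1) * KL (π s) (M.npgStep τ η π s) := by
  set lZ := Real.log (∑ a, π s a * Real.exp (η / (η * τ + 1) * M.advantage τ π s a))
  have key : ∀ {p : S → A → ℝ}, IsPolicy p → (∀ s a, 0 < p s a) →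
      η * M.bellmanGap τ (M.value τ π) p s =
      KL (p s) (π s) - (η * τ + 1) * KL (p s) (M.npgStep τ η π s) + (η * τ + 1) * lZ := by
    intro p hp hp0
    have h : ∀ a, η * (p s a * (M.qValue τ π s a - τ * Real.log (p s a))) =
        p s a * (Real.log (p s a) - Real.log (π s a)) -
        (η * τ + 1) * (p s a * (Real.log (p s a) - Real.log (M.npgStep τ η π s a))) +
        p s a * (η * M.value τ π s + (η * τ + 1) * lZ) := fun a => by
      linear_combination (-p s a) * M.log_npgStep hα hπ hπ0 s a
    rw [bellmanGap_value_eq, mul_sub, Finset.mul_sum, Finset.sum_congr rfl fun a _ => h a,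
      Finset.sum_add_distrib, Finset.sum_sub_distrib, ← Finset.sum_mul, (hp s).2,
      ← Finset.mul_sum, KL_eq_sum_sub (hp0 s) (hπ0 s),
      KL_eq_sum_sub (hp0 s) (M.npgStep_pos hπ hπ0 s)]
    ring
  -- At π itself the gap and KL(π‖π) vanish, which identifies the log-normalizer `lZ` with the
  -- divergence from π to the next policy.
  have h1 := key hπ hπ0
  rw [M.bellmanGap_self hπ, KL_eq_sum_sub (hπ0 s) (hπ0 s)] at h1
  simp only [sub_self, mul_zero, Finset.sum_const_zero] at h1
  rw [key hp hp0]
  linarith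

theorem bellmanGap_npgStep (hα : η * τ + 1 ≠ 0) (hπ : IsPolicy π) (hπ0 : ∀ s a, 0 < π s a)
    (s : S) :
    η * M.bellmanGap τ (M.value τ π) (M.npgStep τ η π) s =
      KL (M.npgStep τ η π s) (π s) + (η * τ + 1) * KL (π s) (M.npgStep τ η π s) := by
  have hp := M.npgStep_pos (τ := τ) (η := η) hπ hπ0
  rw [M.bellmanGap_eq_KL hα hπ hπ0 (M.npgStep_isPolicy hπ hπ0) hp,
    KL_eq_sum_sub (hp s) (hp s)]
  simp

/-- The new policy has a nonnegative Bellman gap against the old value, being a sum of divergences;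
the performance difference lemma averages these gaps. -/
theorem value_le_value_npgStep (hη : 0 < η) (hτ : 0 < τ) (hπ : IsPolicy π)
    (hπ0 : ∀ s a, 0 < π s a) (s : S) : M.value τ π s ≤ M.value τ (M.npgStep τ η π) s := by
  classical
  have hα : 0 < η * τ + 1 := by positivity
  have hp := M.npgStep_pos (τ := τ) (η := η) hπ hπ0
  have hp' := M.npgStep_isPolicy (τ := τ) (η := η) hπ hπ0
  have h := M.valueAt_sub (τ := τ) hp' (single_mem s) (M.value τ π)
  rw [← valueAt, valueAt_single, valueAt_single] at h
  rw [← sub_nonneg, h]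
  refine mul_nonneg (inv_nonneg.2 M.one_sub_γ_pos.le) (Finset.sum_nonneg fun s' _ =>
    mul_nonneg (M.visitation_nonneg hp' (single_mem s) s') ?_)
  refine nonneg_of_mul_nonneg_right (a := η) ?_ hη
  rw [M.bellmanGap_npgStep hα.ne' hπ hπ0]
  exact add_nonneg (KL_nonneg (hp' s') (hπ s') (hπ0 s'))
    (mul_nonneg hα.le (KL_nonneg (hπ s') (hp' s') (hp s')))

end Step

theorem value_le {τ : ℝ} (hτ : 0 ≤ τ) {π : S → A → ℝ} (hπ : IsPolicy π) (s : S) :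
    M.value τ π s ≤ (1 + τ * Fintype.card A) / (1 - M.γ) := by
  classical
  -- Each action contributes at most τ to the entropy bonus, as -x log x ≤ 1 - x, so a stage pays at
  -- most 1 + τ|A|. The constant function C then has nonpositive Bellman gap.
  set C := (1 + τ * Fintype.card A) / (1 - M.γ) with hC
  have hC' : (1 - M.γ) * C = 1 + τ * Fintype.card A := mul_div_cancel₀ _ M.one_sub_γ_pos.ne'
  have h := M.valueAt_sub (τ := τ) hπ (single_mem s) (fun _ => C)
  rw [valueAt_single, ← Finset.sum_mul, (single_mem s).2, one_mul] at h
  rw [← sub_nonpos, h]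
  refine mul_nonpos_of_nonneg_of_nonpos (inv_nonneg.2 M.one_sub_γ_pos.le)
    (Finset.sum_nonpos fun s' _ => mul_nonpos_of_nonneg_of_nonpos
      (M.visitation_nonneg hπ (single_mem s) s') ?_)
  have h1 : ∀ a, π s' a * (M.r s' a + M.γ * ∑ s'', M.P s' a s'' * C - τ * Real.log (π s' a)) ≤
      π s' a * (1 + M.γ * C) + τ := fun a => by
    have h2 := klTerm_nonneg ((hπ s').1 a) one_pos
    have h3 := mul_le_mul_of_nonneg_left (M.r_mem s' a).2 ((hπ s').1 a)
    rw [← Finset.sum_mul, (M.P_mem s' a).2]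
    rw [klTerm, div_one] at h2
    nlinarith [mul_nonneg hτ h2, mul_nonneg hτ ((hπ s').1 a)]
  have h2 := Finset.sum_le_sum fun a (_ : a ∈ Finset.univ) => h1 a
  rw [Finset.sum_add_distrib, ← Finset.sum_mul, (hπ s').2] at h2
  simp only [Finset.sum_const, Finset.card_univ, nsmul_eq_mul] at h2
  rw [bellmanGap]
  linarith

/-! ### Zero advantage, optimality and uniqueness. -/

section Optimal

variable {τ : ℝ} {πs : S → A → ℝ}

/-- Zero advantage says Q - V = τ log πs, so the gap of p is the p-average of τ(log πs - log p). -/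
theorem bellmanGap_eq_neg_KL (hπs0 : ∀ s a, 0 < πs s a)
    (hadv : ∀ s a, M.advantage τ πs s a = 0) {p : S → A → ℝ} (hp : IsPolicy p) (s : S) :
    M.bellmanGap τ (M.value τ πs) p s = -(τ * KL (p s) (πs s)) := by
  have h : ∀ a, p s a * (M.qValue τ πs s a - τ * Real.log (p s a)) =
      p s a * M.value τ πs s - τ * (p s a * Real.log (p s a / πs s a)) := fun a => by
    have h1 := hadv s a
    rw [advantage] at h1
    rcases eq_or_ne (p s a) 0 with h0 | h0
    · simp [h0]
    · rw [Real.log_div h0 (hπs0 s a).ne']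
      linear_combination p s a * h1
  rw [bellmanGap_value_eq, Finset.sum_congr rfl fun a _ => h a, Finset.sum_sub_distrib,
    ← Finset.sum_mul, (hp s).2, ← Finset.mul_sum, KL]
  ring

/-- The suboptimality of a policy is the averaged KL divergence to the optimal policy. -/
theorem valueAt_sub_valueAt (hπs0 : ∀ s a, 0 < πs s a)
    (hadv : ∀ s a, M.advantage τ πs s a = 0) {p : S → A → ℝ} (hp : IsPolicy p) {ρ : S → ℝ}
    (hρ : ρ ∈ stdSimplex ℝ S) :
    M.valueAt τ πs ρ - M.valueAt τ p ρ =
      (1 - M.γ)⁻¹ * ∑ s, M.visitation p ρ s * (τ * KL (p s) (πs s)) := by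
  have h := M.valueAt_sub (τ := τ) hp hρ (M.value τ πs)
  rw [← valueAt] at h
  simp_rw [M.bellmanGap_eq_neg_KL hπs0 hadv hp, mul_neg, Finset.sum_neg_distrib, mul_neg] at h
  linarith

theorem isOptimal_of_advantage_eq_zero (hτ : 0 ≤ τ) (hπs : IsPolicy πs)
    (hπs0 : ∀ s a, 0 < πs s a) (hadv : ∀ s a, M.advantage τ πs s a = 0) : M.IsOptimal τ πs := by
  classical
  refine ⟨hπs, fun p hp s => ?_⟩
  have h := M.valueAt_sub_valueAt hπs0 hadv hp (single_mem s)
  rw [valueAt_single, valueAt_single] at h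
  rw [← sub_nonneg, h]
  exact mul_nonneg (inv_nonneg.2 M.one_sub_γ_pos.le) (Finset.sum_nonneg fun s' _ =>
    mul_nonneg (M.visitation_nonneg hp (single_mem s) s')
      (mul_nonneg hτ (KL_nonneg (hp s') (hπs s') (hπs0 s'))))

/-- Started at s, another optimal policy has zero suboptimality, hence a vanishing weighted sum of
divergences; the weight at s itself is positive. -/
theorem eq_of_isOptimal (hτ : 0 < τ) (hπs : IsPolicy πs)
    (hπs0 : ∀ s a, 0 < πs s a) (hadv : ∀ s a, M.advantage τ πs s a = 0) {p : S → A → ℝ}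
    (hp : M.IsOptimal τ p) : p = πs := by
  classical
  ext1 s
  have h := M.valueAt_sub_valueAt hπs0 hadv hp.1 (single_mem s)
  rw [valueAt_single, valueAt_single] at h
  have hnn : ∀ s' ∈ Finset.univ,
      0 ≤ M.visitation p (Pi.single s 1) s' * (τ * KL (p s') (πs s')) := fun s' _ =>
    mul_nonneg (M.visitation_nonneg hp.1 (single_mem s) s')
      (mul_nonneg hτ.le (KL_nonneg (hp.1 s') (hπs s') (hπs0 s')))
  have h1 : ∑ s', M.visitation p (Pi.single s 1) s' * (τ * KL (p s') (πs s')) = 0 := by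
    refine le_antisymm ?_ (Finset.sum_nonneg hnn)
    have h2 := hp.2 πs hπs s
    refine nonpos_of_mul_nonpos_right (a := (1 - M.γ)⁻¹) ?_ (inv_pos.2 M.one_sub_γ_pos)
    linarith
  rw [Finset.sum_eq_zero_iff_of_nonneg hnn] at h1
  have h3 := h1 s (Finset.mem_univ s)
  have h4 : 0 < M.visitation p (Pi.single s 1) s :=
    M.visitation_pos hp.1 (single_mem s) (by simp)
  exact eq_of_KL_eq_zero (hp.1 s) (hπs s) (hπs0 s)
    (by simpa [h4.ne', hτ.ne'] using h3)

theorem optValueAt_eq (h : M.IsOptimal τ πs) (ρ : S → ℝ) :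
    M.optValueAt τ ρ = M.valueAt τ πs ρ := by
  refine Finset.sum_congr rfl fun s _ => congrArg _ ?_
  have : Nonempty {π : S → A → ℝ // IsPolicy π} := ⟨⟨πs, h.1⟩⟩
  refine le_antisymm (ciSup_le fun p => h.2 p.1 p.2 s) ?_
  exact le_ciSup (f := fun p : {π : S → A → ℝ // IsPolicy π} => M.value τ p.1 s)
    ⟨M.value τ πs s, by rintro _ ⟨p, rfl⟩; exact h.2 p.1 p.2 s⟩ ⟨πs, h.1⟩

end Optimal

/-- Each finite-time law is polynomial in the policy, and the discounted series is dominated by the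
geometric one. -/
theorem tendsto_visitation {π : ℕ → S → A → ℝ} {l : S → A → ℝ} {ρ : S → ℝ}
    (hπ : ∀ k, IsPolicy (π k)) (hρ : ρ ∈ stdSimplex ℝ S)
    (h : ∀ s a, Tendsto (fun k => π k s a) atTop (𝓝 (l s a))) (s : S) :
    Tendsto (fun k => M.visitation (π k) ρ s) atTop (𝓝 (M.visitation l ρ s)) := by
  have hlaw : ∀ t s, Tendsto (fun k => M.stateLaw (π k) ρ t s) atTop (𝓝 (M.stateLaw l ρ t s)) := by
    intro t
    induction t with
    | zero => exact fun s => tendsto_const_nhds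
    | succ t ih =>
      exact fun s' => tendsto_finsetSum _ fun s _ => tendsto_finsetSum _ fun a _ =>
        ((ih s).mul (h s a)).mul_const _
  refine Tendsto.const_mul _ (tendsto_tsum_of_dominated_convergence
    (summable_geometric_of_lt_one M.γ_mem.1 M.γ_mem.2) (fun t => (hlaw t s).const_mul _)
    (Eventually.of_forall fun k t => ?_))
  have h := M.stateLaw_mem (hπ k) hρ t
  have h1 : M.stateLaw (π k) ρ t s ≤ 1 := by
    rw [← h.2]
    exact Finset.single_le_sum (fun i _ => h.1 i) (Finset.mem_univ s)
  rw [Real.norm_of_nonneg (mul_nonneg (pow_nonneg M.γ_mem.1 _) (h.1 s))]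
  exact mul_le_of_le_one_right (pow_nonneg M.γ_mem.1 _) h1

/-! ### Convergence of the iterates. -/

section Iterates

variable {τ η : ℝ} {π₀ : S → A → ℝ}

theorem npg_succ (k : ℕ) : M.npg τ η π₀ (k + 1) = M.npgStep τ η (M.npg τ η π₀ k) :=
  Function.iterate_succ_apply' _ _ _

theorem npg_isPolicy_and_pos (hπ : IsPolicy π₀) (hπ0 : ∀ s a, 0 < π₀ s a) (k : ℕ) :
    IsPolicy (M.npg τ η π₀ k) ∧ ∀ s a, 0 < M.npg τ η π₀ k s a := by
  induction k with
  | zero => exact ⟨hπ, hπ0⟩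
  | succ k ih =>
    rw [npg_succ]
    exact ⟨M.npgStep_isPolicy ih.1 ih.2, M.npgStep_pos ih.1 ih.2⟩

/-- The iterates converge to a policy with vanishing advantage. -/
theorem exists_tendsto_npg (hη : 0 < η) (hτ : 0 < τ) (hπ : IsPolicy π₀)
    (hπ0 : ∀ s a, 0 < π₀ s a) :
    ∃ πs : S → A → ℝ, IsPolicy πs ∧ (∀ s a, 0 < πs s a) ∧
      (∀ s a, M.advantage τ πs s a = 0) ∧
      ∀ s a, Tendsto (fun k => M.npg τ η π₀ k s a) atTop (𝓝 (πs s a)) := by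
  have hα : 0 < η * τ + 1 := by positivity
  set p := M.npg τ η π₀ with hp_def
  have hp : ∀ k, IsPolicy (p k) := fun k => (M.npg_isPolicy_and_pos hπ hπ0 k).1
  have hp0 : ∀ k s a, 0 < p k s a := fun k => (M.npg_isPolicy_and_pos hπ hπ0 k).2
  have hVlim : ∀ s, ∃ l, Tendsto (fun k => M.value τ (p k) s) atTop (𝓝 l) := fun s => by
    have hmono : Monotone fun k => M.value τ (p k) s := monotone_nat_of_le_succ fun k => by
      rw [hp_def, npg_succ]
      exact M.value_le_value_npgStep hη hτ (hp k) (hp0 k) s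
    exact ⟨_, tendsto_atTop_ciSup hmono ⟨_, by rintro _ ⟨k, rfl⟩; exact M.value_le hτ.le (hp k) s⟩⟩
  choose V hV using hVlim
  set Q : S → A → ℝ := fun s a => M.r s a + M.γ * ∑ s', M.P s a s' * V s' with hQ_def
  have hQ : ∀ s a, Tendsto (fun k => M.qValue τ (p k) s a) atTop (𝓝 (Q s a)) := fun s a =>
    ((tendsto_finsetSum _ fun s' _ => (hV s').const_mul _).const_mul _).const_add _
  have hL : ∀ s a b, Tendsto (fun k => Real.log (p k s b) - Real.log (p k s a)) atTop
      (𝓝 ((Q s b - Q s a) / τ)) := fun s a b => by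
    -- Differencing two actions removes the value and the normalizer. The fixed point is η/(ητ+1) ·
    -- ΔQ / (1 - 1/(ητ+1)) = ΔQ/τ.
    have h1 := tendsto_of_contracting_recursion (β := 1 / (η * τ + 1))
      (b := η / (η * τ + 1) * (Q s b - Q s a))
      (x := fun k => Real.log (p k s b) - Real.log (p k s a))
      (e := fun k => η / (η * τ + 1) * (M.qValue τ (p k) s b - M.qValue τ (p k) s a))
      (by positivity) ((div_lt_one hα).2 (by nlinarith [mul_pos hη hτ]))
      (((hQ s b).sub (hQ s a)).const_mul _) fun k => by
        have ha := M.log_npgStep hα.ne' (hp k) (hp0 k) s a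
        have hb := M.log_npgStep hα.ne' (hp k) (hp0 k) s b
        rw [← npg_succ] at ha hb
        field_simp
        linear_combination hb - ha
    convert h1 using 2
    have : η * τ + 1 - 1 ≠ 0 := by simp [hη.ne', hτ.ne']
    field_simp
    ring
  -- The softmax of Q/τ, written through ratios only: a probability is the reciprocal of the sum of
  -- all ratios to it, so convergence of log-ratios is enough.
  set πs : S → A → ℝ := fun s a => (∑ b, Real.exp ((Q s b - Q s a) / τ))⁻¹ with hπs_def
  have hne : ∀ s : S, Nonempty A := fun s => by
    by_contra h
    rw [not_nonempty_iff] at h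
    simpa using (hπ s).2
  have hsum : ∀ s a, 0 < ∑ b, Real.exp ((Q s b - Q s a) / τ) := fun s a =>
    have := hne s
    Finset.sum_pos (fun _ _ => Real.exp_pos _) Finset.univ_nonempty
  have hlim : ∀ s a, Tendsto (fun k => p k s a) atTop (𝓝 (πs s a)) := fun s a => by
    have h1 : ∀ k, p k s a = (∑ b, Real.exp (Real.log (p k s b) - Real.log (p k s a)))⁻¹ := by
      intro k
      simp_rw [Real.exp_sub, Real.exp_log (hp0 k s _)]
      rw [← Finset.sum_div, (hp k s).2, one_div, inv_inv]
    exact ((tendsto_finsetSum _ fun b _ => (Real.continuous_exp.tendsto _).comp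
      (hL s a b)).inv₀ (hsum s a).ne').congr fun k => (h1 k).symm
  have hπs0 : ∀ s a, 0 < πs s a := fun s a => inv_pos.2 (hsum s a)
  have hπs : IsPolicy πs := fun s => ⟨fun a => (hπs0 s a).le, by
    have h1 := tendsto_finsetSum Finset.univ fun a _ => hlim s a
    simp_rw [(hp _ s).2] at h1
    exact (tendsto_nhds_unique tendsto_const_nhds h1).symm⟩
  have hlog : ∀ s a, Tendsto (fun k => Real.log (p k s a)) atTop (𝓝 (Real.log (πs s a))) :=
    fun s a => (hlim s a).log (hπs0 s a).ne'
  have hbell : ∀ s, M.bellmanGap τ V πs s = 0 := fun s => by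
    have h1 : Tendsto (fun k => M.bellmanGap τ (M.value τ (p k)) (p k) s) atTop
        (𝓝 (M.bellmanGap τ V πs s)) :=
      (tendsto_finsetSum _ fun a _ =>
        (hlim s a).mul ((hQ s a).sub ((hlog s a).const_mul τ))).sub (hV s)
    simp_rw [M.bellmanGap_self (hp _)] at h1
    exact (tendsto_nhds_unique tendsto_const_nhds h1).symm
  have hval : M.value τ πs = V := funext (M.value_eq_of_bellmanGap_eq_zero hπs hbell)
  refine ⟨πs, hπs, hπs0, fun s a => ?_, hlim⟩
  -- Q - τ log πs is constant in the action, and the Bellman equation forces the constant to be V: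
  -- the advantage vanishes.
  have hdiff : ∀ b, Q s b - τ * Real.log (πs s b) = Q s a - τ * Real.log (πs s a) := fun b => by
    have h1 := tendsto_nhds_unique (hL s a b) ((hlog s b).sub (hlog s a))
    rw [div_eq_iff hτ.ne'] at h1
    linear_combination h1
  have h2 := hbell s
  rw [bellmanGap] at h2
  change ∑ b, πs s b * (Q s b - τ * Real.log (πs s b)) - V s = 0 at h2
  simp_rw [hdiff] at h2
  rw [← Finset.sum_mul, (hπs s).2, one_mul] at h2
  rw [advantage, qValue, hval]
  exact h2

end Iterates

end MDP

end EntropyNPG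

/-! ### The local rate. -/

namespace EntropyNPG

theorem abs_sum_mul_sub_sum_mul_le {ι : Type*} [Fintype ι] {ε δ : ℝ}
    (hδ : δ ≤ 1) {d e x y : ι → ℝ} (he : ∀ i, 0 ≤ e i) (hx : ∀ i, 0 ≤ x i)
    (hde : ∀ i, |d i - e i| ≤ δ * e i) (hxy : ∀ i, |y i - x i| ≤ ε * x i) :
    |∑ i, d i * y i - ∑ i, e i * x i| ≤ (2 * ε + δ) * ∑ i, e i * x i := by
  rw [← Finset.sum_sub_distrib, Finset.mul_sum]
  refine (Finset.abs_sum_le_sum_abs _ _).trans (Finset.sum_le_sum fun i _ => ?_)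
  -- Since δ ≤ 1; this crude factor is the 2 in 2ε + δ and avoids a product term εδ.
  have h1 : |d i| ≤ 2 * e i := by
    have h2 := hde i
    have h3 := mul_le_of_le_one_left (he i) hδ
    rw [abs_le] at h2 ⊢
    constructor <;> linarith [he i]
  calc |d i * y i - e i * x i| = |d i * (y i - x i) + (d i - e i) * x i| := by ring_nf
    _ ≤ |d i| * |y i - x i| + |d i - e i| * |x i| := by
      rw [← abs_mul, ← abs_mul]; exact abs_add_le _ _
    _ ≤ 2 * e i * (ε * x i) + δ * e i * x i := by
      rw [abs_of_nonneg (hx i)]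
      gcongr
      · linarith [he i]
      · exact hxy i
      · exact hx i
      · exact hde i
    _ = (2 * ε + δ) * (e i * x i) := by ring

/-- Elimination of b, c, e: with θ = 0 the relations force α²y = x. The three errors enter with
weights 1+α, (1+α)α and α(α-1), whose sum is 1 + α + 2α². -/
theorem abs_sq_mul_sub_le {α θ x y b c e : ℝ} (hα : 1 ≤ α) (hθ : 0 ≤ θ) (hy : 0 ≤ y)
    (hyx : y ≤ x)
    (hb : |b - x| ≤ θ * x) (hc : |c - y| ≤ θ * y)
    (he : |(1 + α) * e - (α - 1) * (x - y)| ≤ θ * ((α - 1) * (x - y)))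
    (h : (α - 1) * x = b - α * c + α * e) :
    |2 * (α ^ 2 * y - x)| ≤ θ * (1 + α + 2 * α ^ 2) * x := by
  have h1 : 2 * (α ^ 2 * y - x) = (1 + α) * (b - x) + -((1 + α) * α * (c - y)) +
      α * ((1 + α) * e - (α - 1) * (x - y)) := by
    linear_combination (1 + α) * h
  have hc' : |c - y| ≤ θ * x := hc.trans (mul_le_mul_of_nonneg_left hyx hθ)
  have he' : |(1 + α) * e - (α - 1) * (x - y)| ≤ θ * ((α - 1) * x) := he.trans (by
    gcongr
    linarith)
  rw [h1]
  calc _ ≤ |(1 + α) * (b - x)| + |-((1 + α) * α * (c - y))| +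
        |α * ((1 + α) * e - (α - 1) * (x - y))| := abs_add_three _ _ _
    _ = (1 + α) * |b - x| + (1 + α) * α * |c - y| +
        α * |(1 + α) * e - (α - 1) * (x - y)| := by
      have hα0 : 0 ≤ α := by linarith
      rw [abs_neg, abs_mul, abs_mul, abs_mul, abs_mul, abs_of_nonneg hα0,
        abs_of_nonneg (by linarith : 0 ≤ 1 + α)]
    _ ≤ (1 + α) * (θ * x) + (1 + α) * α * (θ * x) + α * (θ * ((α - 1) * x)) := by gcongr
    _ = _ := by ring

variable {S : Type u} {A : Type v} [Fintype S] [Fintype A]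

/-- The relative error of the local rate, which serves both as upper and as lower deviation. -/
noncomputable def rateError (α ε δ : ℝ) : ℝ := (ε + δ) * (1 + α + 2 * α ^ 2)

theorem abs_sub_le_mul_of_div {x y δ : ℝ} (hy : 0 < y) (h : |x / y - 1| ≤ δ) :
    |x - y| ≤ δ * y := by
  rwa [div_sub_one hy.ne', abs_div, abs_of_pos hy, div_le_iff₀ hy] at h

theorem LocalRegime.abs_sub_le {M : MDP S A} {τ η ε δ : ℝ} (hη : 0 < η) (hτ : 0 < τ)
    (hε : 0 ≤ ε) (hδ : 0 ≤ δ) (hδ1 : δ ≤ 1) {ρ : S → ℝ} (hρ : ρ ∈ stdSimplex ℝ S)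
    (hρ0 : ∀ s, 0 < ρ s) {π₀ πs : S → A → ℝ} (hπ : IsPolicy π₀) (hπ0 : ∀ s a, 0 < π₀ s a)
    (hπs : IsPolicy πs) (hπs0 : ∀ s a, 0 < πs s a) (hadv : ∀ s a, M.advantage τ πs s a = 0)
    {T : ℕ} (hT : LocalRegime M τ η ρ π₀ πs ε δ T) {k : ℕ} (hk : T ≤ k) :
    |(η * τ + 1) ^ 2 * (M.valueAt τ πs ρ - M.valueAt τ (M.npg τ η π₀ (k + 1)) ρ) -
        (M.valueAt τ πs ρ - M.valueAt τ (M.npg τ η π₀ k) ρ)| ≤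
      rateError (η * τ + 1) ε δ * (M.valueAt τ πs ρ - M.valueAt τ (M.npg τ η π₀ k) ρ) := by
  set α := η * τ + 1 with hα_def
  have hητ : 0 < η * τ := mul_pos hη hτ
  have hα : 0 < α := by linarith
  obtain ⟨hp, hp0⟩ := M.npg_isPolicy_and_pos (τ := τ) (η := η) hπ hπ0 k
  obtain ⟨hq, hq0⟩ := M.npg_isPolicy_and_pos (τ := τ) (η := η) hπ hπ0 (k + 1)
  have hT0 := hT k hk
  have hT1 := hT (k + 1) (by omega)
  have hqs := M.npg_succ (τ := τ) (η := η) (π₀ := π₀) k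
  set p := M.npg τ η π₀ k
  set q := M.npg τ η π₀ (k + 1)
  set c := (1 - M.γ)⁻¹ with hc_def
  have hc : 0 < c := inv_pos.2 M.one_sub_γ_pos
  have hx := M.valueAt_sub_valueAt hπs0 hadv hp hρ
  have hy := M.valueAt_sub_valueAt hπs0 hadv hq hρ
  have hz := M.valueAt_sub (τ := τ) hπs hρ (M.value τ p)
  have hw := M.valueAt_sub (τ := τ) hq hρ (M.value τ p)
  rw [← MDP.valueAt, ← hc_def] at hz hw
  -- The three point identity tested at the optimal policy, then at the next iterate.
  have hz' : η * (M.valueAt τ πs ρ - M.valueAt τ p ρ) = c * ∑ s, M.visitation πs ρ s *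
      (KL (πs s) (p s) - α * KL (πs s) (q s) + α * KL (p s) (q s)) := by
    rw [hz, mul_left_comm, Finset.mul_sum]
    refine congrArg _ (Finset.sum_congr rfl fun s _ => ?_)
    rw [mul_left_comm, M.bellmanGap_eq_KL hα.ne' hp hp0 hπs hπs0, hqs]
  have hw' : η * (M.valueAt τ q ρ - M.valueAt τ p ρ) = c * ∑ s, M.visitation q ρ s *
      (KL (q s) (p s) + α * KL (p s) (q s)) := by
    rw [hw, mul_left_comm, Finset.mul_sum]
    refine congrArg _ (Finset.sum_congr rfl fun s _ => ?_)
    rw [mul_left_comm, hqs, M.bellmanGap_npgStep hα.ne' hp hp0]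
  have hdp := M.visitation_nonneg hp hρ
  have hdq := M.visitation_nonneg hq hρ
  have hKp := fun s => KL_nonneg (hp s) (hπs s) (hπs0 s)
  have hKq := fun s => KL_nonneg (hq s) (hπs s) (hπs0 s)
  have hKqp := fun s => KL_nonneg (hq s) (hp s) (hp0 s)
  have hKpq := fun s => KL_nonneg (hp s) (hq s) (hq0 s)
  have hdp' := fun s => abs_sub_le_mul_of_div (M.visitation_pos hp hρ (hρ0 s)) (hT0 s).2.2.1
  have hdq' := fun s => abs_sub_le_mul_of_div (M.visitation_pos hq hρ (hρ0 s)) (hT1 s).2.2.1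
  have e1 := abs_sum_mul_sub_sum_mul_le hδ1 hdp hKp hdp' fun s => (hT0 s).2.1.2
  have e2 := abs_sum_mul_sub_sum_mul_le hδ1 hdq hKq hdq' fun s => (hT1 s).2.1.2
  -- Near-symmetry merges KL(q‖p) + α KL(p‖q) into (1+α) KL(p‖q), while the weights change from
  -- those of q to those of πs.
  have e3 := abs_sum_mul_sub_sum_mul_le (y := fun s => (1 + α) * KL (p s) (q s)) hδ1 hdq
    (fun s => add_nonneg (hKqp s) (mul_nonneg hα.le (hKpq s))) hdq' fun s => by
      rw [show (1 + α) * KL (p s) (q s) - (KL (q s) (p s) + α * KL (p s) (q s)) =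
        KL (p s) (q s) - KL (q s) (p s) by ring]
      refine (hT0 s).1.1.trans (mul_le_mul_of_nonneg_left ?_ hε)
      exact le_add_of_nonneg_right (mul_nonneg hα.le (hKpq s))
  have hsum : ∀ (f g : S → ℝ), ∑ s, f s * (τ * g s) = τ * ∑ s, f s * g s := fun f g => by
    rw [Finset.mul_sum]; exact Finset.sum_congr rfl fun s _ => by ring
  rw [hsum] at hx hy
  set B := ∑ s, M.visitation πs ρ s * KL (πs s) (p s)
  set C := ∑ s, M.visitation πs ρ s * KL (πs s) (q s)
  have hE : ∑ s, M.visitation πs ρ s * ((1 + α) * KL (p s) (q s)) =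
      (1 + α) * ∑ s, M.visitation πs ρ s * KL (p s) (q s) := by
    rw [Finset.mul_sum]; exact Finset.sum_congr rfl fun s _ => by ring
  rw [hE] at e3
  set E := ∑ s, M.visitation πs ρ s * KL (p s) (q s)
  have hz2 : ∑ s, M.visitation πs ρ s *
      (KL (πs s) (p s) - α * KL (πs s) (q s) + α * KL (p s) (q s)) = B - α * C + α * E := by
    rw [Finset.mul_sum, Finset.mul_sum, ← Finset.sum_sub_distrib, ← Finset.sum_add_distrib]
    exact Finset.sum_congr rfl fun s _ => by ring
  rw [hz2] at hz'
  have hX0 : 0 ≤ ∑ s, M.visitation q ρ s * KL (q s) (πs s) :=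
    Finset.sum_nonneg fun s _ => mul_nonneg (hdq s) (hKq s)
  have hG0 : 0 ≤ ∑ s, M.visitation q ρ s * (KL (q s) (p s) + α * KL (p s) (q s)) :=
    Finset.sum_nonneg fun s _ => mul_nonneg (hdq s)
      (add_nonneg (hKqp s) (mul_nonneg hα.le (hKpq s)))
  set X := ∑ s, M.visitation p ρ s * KL (p s) (πs s)
  set Y := ∑ s, M.visitation q ρ s * KL (q s) (πs s)
  set G := ∑ s, M.visitation q ρ s * (KL (q s) (p s) + α * KL (p s) (q s))
  have hG : G = η * τ * (X - Y) := by
    refine mul_left_cancel₀ hc.ne' ?_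
    rw [← hw', show M.valueAt τ q ρ - M.valueAt τ p ρ = (M.valueAt τ πs ρ - M.valueAt τ p ρ) -
      (M.valueAt τ πs ρ - M.valueAt τ q ρ) by ring, hx, hy]
    ring
  have hZ : η * τ * X = B - α * C + α * E := by
    refine mul_left_cancel₀ hc.ne' ?_
    rw [← hz', hx]
    ring
  have hητ' : η * τ = α - 1 := by rw [hα_def]; ring
  rw [hητ'] at hG hZ hητ
  have hYX : Y ≤ X := by
    rw [hG] at hG0
    exact sub_nonneg.1 (nonneg_of_mul_nonneg_right hG0 hητ)
  rw [hG] at e3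
  have hθ : 0 ≤ 2 * ε + δ := by positivity
  have key := abs_sq_mul_sub_le (by linarith) hθ hX0 hYX e1 e2 e3 hZ
  have hfin : |α ^ 2 * Y - X| ≤ rateError α ε δ * X := by
    rw [abs_mul, abs_of_pos two_pos] at key
    -- Halving 2ε + δ gives ε + δ/2, rounded up to the ε + δ of `rateError`.
    have h1 : (2 * ε + δ) * (1 + α + 2 * α ^ 2) * X ≤ 2 * (rateError α ε δ * X) := by
      have hX : 0 ≤ (1 + α + 2 * α ^ 2) * X := mul_nonneg (by positivity) (hX0.trans hYX)
      rw [rateError]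
      nlinarith [mul_nonneg hδ hX]
    linarith
  rw [hx, hy, show α ^ 2 * (c * (τ * Y)) - c * (τ * X) = c * τ * (α ^ 2 * Y - X) by ring, abs_mul,
    abs_of_pos (mul_pos hc hτ), show rateError α ε δ * (c * (τ * X)) =
      c * τ * (rateError α ε δ * X) by ring]
  exact mul_le_mul_of_nonneg_left hfin (mul_pos hc hτ).le

/-- Every limit involved is positive, so all ratios of probabilities and of visitations tend to 1;
finiteness of the state space makes the time uniform. -/
theorem exists_localRegime {M : MDP S A} {τ η ε δ : ℝ} (hε : 0 < ε) (hδ : 0 < δ) {ρ : S → ℝ}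
    (hρ : ρ ∈ stdSimplex ℝ S) (hρ0 : ∀ s, 0 < ρ s) {π₀ πs : S → A → ℝ} (hπ : IsPolicy π₀)
    (hπ0 : ∀ s a, 0 < π₀ s a) (hπs : IsPolicy πs) (hπs0 : ∀ s a, 0 < πs s a)
    (hlim : ∀ s a, Tendsto (fun k => M.npg τ η π₀ k s a) atTop (𝓝 (πs s a))) :
    ∃ T, LocalRegime M τ η ρ π₀ πs ε δ T := by
  have hp := fun k => (M.npg_isPolicy_and_pos (τ := τ) (η := η) hπ hπ0 k).1
  have hp0 := fun k => (M.npg_isPolicy_and_pos (τ := τ) (η := η) hπ hπ0 k).2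
  refine eventually_atTop.1 (eventually_all.2 fun s => ?_)
  have h1 := eventually_klRatioClose hε (fun k => hp k s) (fun k => hp (k + 1) s)
    (fun k => hp0 k s) (fun k => hp0 (k + 1) s) (hπs0 s) (hlim s)
    fun a => (tendsto_add_atTop_iff_nat 1).2 (hlim s a)
  have h2 := eventually_klRatioClose hε (fun k => hp k s) (fun _ => hπs s)
    (fun k => hp0 k s) (fun _ => hπs0 s) (hπs0 s) (hlim s) fun a => tendsto_const_nhds
  have hd := M.tendsto_visitation hp hρ hlim s
  have hd0 := (M.visitation_pos hπs hρ (hρ0 s)).ne'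
  have key : ∀ {f : ℕ → ℝ}, Tendsto f atTop (𝓝 1) → ∀ᶠ k in atTop, |f k - 1| ≤ δ := fun hf =>
    (hf.eventually (Metric.closedBall_mem_nhds 1 hδ))
  have h3 := key (div_self hd0 ▸ tendsto_const_nhds.div hd hd0)
  have h4 := key (div_self hd0 ▸ hd.div_const (M.visitation πs ρ s))
  filter_upwards [h1, h2, h3, h4] with k h1 h2 h3 h4 using ⟨h1, h2, h3, h4⟩

theorem rateError_nonneg {α ε δ : ℝ} (hα : 0 ≤ α) (hε : 0 ≤ ε) (hδ : 0 ≤ δ) :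
    0 ≤ rateError α ε δ := by
  rw [rateError]; positivity

theorem tendsto_rateError (α : ℝ) (s : Set (ℝ × ℝ)) :
    Tendsto (fun p : ℝ × ℝ => rateError α p.1 p.2) (𝓝[s] (0, 0)) (𝓝 0) := by
  have h : Continuous fun p : ℝ × ℝ => rateError α p.1 p.2 := by unfold rateError; fun_prop
  simpa [rateError] using (h.tendsto (0, 0)).mono_left nhdsWithin_le_nhds

end EntropyNPG

theorem theorem6p17 (η τ : ℝ) (hη : 0 < η) (hτ : 0 < τ) :
    ∃ σ₁ σ₂ : ℝ → ℝ → ℝ,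
      (∀ ε ∈ Set.Ioo (0 : ℝ) 1, ∀ δ ∈ Set.Ioo (0 : ℝ) 1, 0 ≤ σ₁ ε δ ∧ 0 ≤ σ₂ ε δ) ∧
      Tendsto (fun p : ℝ × ℝ => σ₁ p.1 p.2)
        (𝓝[Set.Ioo (0 : ℝ) 1 ×ˢ Set.Ioo (0 : ℝ) 1] (0, 0)) (𝓝 0) ∧
      Tendsto (fun p : ℝ × ℝ => σ₂ p.1 p.2)
        (𝓝[Set.Ioo (0 : ℝ) 1 ×ˢ Set.Ioo (0 : ℝ) 1] (0, 0)) (𝓝 0) ∧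
      ∀ (S : Type u) (A : Type v) [Fintype S] [Fintype A] (M : MDP S A)
        (ρ : S → ℝ) (_ : ρ ∈ stdSimplex ℝ S) (_ : ∀ s, 0 < ρ s)
        (π₀ : S → A → ℝ) (_ : IsPolicy π₀) (_ : ∀ s a, 0 < π₀ s a),
        ∃ πs : S → A → ℝ,
          M.IsOptimal τ πs ∧ (∀ π' : S → A → ℝ, M.IsOptimal τ π' → π' = πs) ∧
          (∀ ε ∈ Set.Ioo (0 : ℝ) 1, ∀ δ ∈ Set.Ioo (0 : ℝ) 1,
            (∃ T : ℕ, LocalRegime M τ η ρ π₀ πs ε δ T) ∧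
            ∀ T : ℕ, LocalRegime M τ η ρ π₀ πs ε δ T → ∀ k ≥ T,
              (1 - σ₁ ε δ) / (η * τ + 1) ^ 2 *
                  (M.optValueAt τ ρ - M.valueAt τ (M.npg τ η π₀ k) ρ) ≤
                M.optValueAt τ ρ - M.valueAt τ (M.npg τ η π₀ (k + 1)) ρ ∧
              M.optValueAt τ ρ - M.valueAt τ (M.npg τ η π₀ (k + 1)) ρ ≤
                (1 + σ₂ ε δ) / (η * τ + 1) ^ 2 *
                  (M.optValueAt τ ρ - M.valueAt τ (M.npg τ η π₀ k) ρ)) ∧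
          ((∀ k, M.valueAt τ (M.npg τ η π₀ k) ρ ≠ M.optValueAt τ ρ) →
            Tendsto (fun k => (M.optValueAt τ ρ - M.valueAt τ (M.npg τ η π₀ (k + 1)) ρ) /
                (M.optValueAt τ ρ - M.valueAt τ (M.npg τ η π₀ k) ρ))
              atTop (𝓝 (1 / (η * τ + 1) ^ 2))) := by
  have hα : 0 < η * τ + 1 := by positivity
  have hα2 : 0 < (η * τ + 1) ^ 2 := by positivity
  refine ⟨rateError (η * τ + 1), rateError (η * τ + 1), fun ε hε δ hδ =>
    ⟨rateError_nonneg hα.le hε.1.le hδ.1.le, rateError_nonneg hα.le hε.1.le hδ.1.le⟩,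
    tendsto_rateError _ _, tendsto_rateError _ _, fun S A _ _ M ρ hρ hρ0 π₀ hπ hπ0 => ?_⟩
  obtain ⟨πs, hπs, hπs0, hadv, hlim⟩ := M.exists_tendsto_npg hη hτ hπ hπ0
  have hopt := M.isOptimal_of_advantage_eq_zero hτ.le hπs hπs0 hadv
  rw [M.optValueAt_eq hopt]
  have hT : ∀ {ε δ : ℝ}, 0 < ε → 0 < δ → ∃ T, LocalRegime M τ η ρ π₀ πs ε δ T :=
    fun hε hδ => exists_localRegime hε hδ hρ hρ0 hπ hπ0 hπs hπs0 hlim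
  have hrate : ∀ {ε δ : ℝ}, 0 < ε → 0 < δ → δ < 1 → ∀ {T : ℕ},
      LocalRegime M τ η ρ π₀ πs ε δ T → ∀ k ≥ T, _ := fun hε hδ hδ1 T h k hk =>
    h.abs_sub_le hη hτ hε.le hδ.le hδ1.le hρ hρ0 hπ hπ0 hπs hπs0 hadv hk
  refine ⟨πs, hopt, fun π' h => M.eq_of_isOptimal hτ hπs hπs0 hadv h, fun ε hε δ hδ =>
    ⟨hT hε.1 hδ.1, fun T hTr k hk => ?_⟩, fun hne => ?_⟩
  · have h := abs_le.1 (hrate hε.1 hδ.1 hδ.2 hTr k hk)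
    rw [div_mul_eq_mul_div, div_mul_eq_mul_div, div_le_iff₀ hα2, le_div_iff₀ hα2]
    constructor <;> linarith [h.1, h.2]
  · have hpos : ∀ k, 0 < M.valueAt τ πs ρ - M.valueAt τ (M.npg τ η π₀ k) ρ := fun k =>
      lt_of_le_of_ne (sub_nonneg.2 (Finset.sum_le_sum fun s _ => mul_le_mul_of_nonneg_left
        (hopt.2 _ (M.npg_isPolicy_and_pos hπ hπ0 k).1 s) (hρ0 s).le))
        (sub_ne_zero.2 (hne k).symm).symm
    have hc : 0 < 1 + (η * τ + 1) + 2 * (η * τ + 1) ^ 2 := by positivity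
    rw [Metric.tendsto_atTop]
    intro e he
    set c := 1 + (η * τ + 1) + 2 * (η * τ + 1) ^ 2 with hc_def
    -- Used as both ε and δ: the rate error is 2tc ≤ e(ητ+1)²/2, strictly below what is needed, and
    -- the cap 1/2 keeps t < 1.
    set t := min (1 / 2) (e * (η * τ + 1) ^ 2 / (4 * c)) with ht
    have ht0 : 0 < t := by positivity
    have ht1 : t ≤ 1 / 2 := min_le_left _ _
    have ht2 : t * (4 * c) ≤ e * (η * τ + 1) ^ 2 :=
      (le_div_iff₀ (by positivity)).1 (min_le_right _ _)
    obtain ⟨T, hTr⟩ := hT ht0 ht0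
    refine ⟨T, fun k hk => ?_⟩
    have h := hrate ht0 ht0 (by linarith) hTr k hk
    have hk0 := hpos k
    set x := M.valueAt τ πs ρ - M.valueAt τ (M.npg τ η π₀ k) ρ
    set y := M.valueAt τ πs ρ - M.valueAt τ (M.npg τ η π₀ (k + 1)) ρ
    have h2 : y / x - 1 / (η * τ + 1) ^ 2 = ((η * τ + 1) ^ 2 * y - x) / ((η * τ + 1) ^ 2 * x) := by
      field_simp
    rw [Real.dist_eq, h2, abs_div, abs_of_pos (mul_pos hα2 hk0), div_lt_iff₀ (mul_pos hα2 hk0)]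
    refine h.trans_lt ?_
    rw [rateError, ← hc_def, ← mul_assoc]
    refine mul_lt_mul_of_pos_right ?_ hk0
    nlinarith [mul_pos ht0 hc]
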